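/- Let $\alpha_{88}=\sqrt{6+2\sqrt2}/2$; it is the largest real root of $4x^4-12x^2+7$. Let $a>b>0$ and consider the elliptic billiard bounded by $x^2/a^2+y^2/b^2=1$. A 3-periodic is a triangle with three distinct vertices on this ellipse such that, at each vertex, the two sides make equal angles with the normal of the ellipse. The triangle center $X_{88}$ (the isogonal conjugate of $X_{44}$) of a triangle $P_1P_2P_3$ with sidelengths $s_1=|P_2P_3|$, $s_2=|P_3P_1|$, $s_3=|P_1P_2|$ is the point with trilinear coordinates $$\frac1{s_2+s_3-2s_1}:\frac1{s_3+s_1-2s_2}:\frac1{s_1+s_2-2s_3}$$ (denominators cleared where one of them vanishes). A triangle is a sideways isosceles if it is isosceles with the $x$-axis as its axis of symmetry. For every $t\in\mathbb R$ there is a 3-periodic with first vertex $P_1(t)=(a\cos t,b\sin t)$. Let $P_1(t)P_2(t)P_3(t)$, $t\in\mathbb R$, be any choice of such 3-periodics, and let $X_{88}(t)$ be the center $X_{88}$ of $P_1(t)P_2(t)P_3(t)$. At $t=0$ the 3-periodic is a sideways isosceles, and: 1. If $a/b=\alpha_{88}$, then the derivative with respect to $t$ of the $y$-coordinate of $X_{88}(t)$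 exists and vanishes at every $t$ at which the 3-periodic is a sideways isosceles. 2. $X_{88}$ moves on the billiard: there is a differentiable function $\theta:\mathbb R\to\mathbb R$ with $X_{88}(t)=(a\cos\theta(t),b\sin\theta(t))$ for all $t$. The value $\alpha_{88}$ is the threshold for non-monotonic motion (as $t$ increases, $P_1(t)$ moves counterclockwise): - if $a/b<\alpha_{88}$, the motion of $X_{88}$ is clockwise without stops: $\theta'(t)<0$ for all $t$; - if $a/b=\alpha_{88}$, the motion is clockwise with stops: $\theta$ is strictly decreasing, and $\theta'(t)=0$ exactly when $X_{88}(t)$ is one of the vertices $(\pm a,0)$ of the ellipse, which is exactly when the 3-periodic is a sideways isosceles; - if $a/b>\alpha_{88}$, the motion is non-monotonic: $\theta'(t)<0$ for some $t$ and $\theta'(t)>0$ for some $t$. -/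

import Mathlib

noncomputable section

namespace EllipticBilliard

/-- The Euclidean plane. -/
abbrev Plane : Type := EuclideanSpace ℝ (Fin 2)

/-- The boundary of the elliptic billiard with semi-axes `a` and `b`. -/
def boundary (a b : ℝ) : Set Plane :=
  {p | (p 0 / a) ^ 2 + (p 1 / b) ^ 2 = 1}

/-- The point `(a cos t, b sin t)`. -/
def ellipsePoint (a b t : ℝ) : Plane :=
  !₂[a * Real.cos t, b * Real.sin t]

/-- A normal vector of the billiard boundary at the point `q`: half of the gradient of
`(x / a) ^ 2 + (y / b) ^ 2`. -/
def normalVec (a b : ℝ) (q : Plane) : Plane :=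
  !₂[q 0 / a ^ 2, q 1 / b ^ 2]

/-- The reflection law at the boundary point `q` for a trajectory from `p` to `q` to `r`: the
two segments at `q` make equal angles with the normal of the boundary. -/
def ReflectsAt (a b : ℝ) (p q r : Plane) : Prop :=
  InnerProductGeometry.angle (p - q) (normalVec a b q) =
    InnerProductGeometry.angle (r - q) (normalVec a b q)

/-- `p q r` is a 3-periodic trajectory of the elliptic billiard: three distinct points of the
boundary, with the reflection law at each of them. -/
structure IsThreePeriodic (a b : ℝ) (p q r : Plane) : Prop where
  mem_p : p ∈ boundary a b
  mem_q : q ∈ boundary a b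
  mem_r : r ∈ boundary a b
  p_ne_q : p ≠ q
  q_ne_r : q ≠ r
  r_ne_p : r ≠ p
  reflects_p : ReflectsAt a b r p q
  reflects_q : ReflectsAt a b p q r
  reflects_r : ReflectsAt a b q r p

/-- The family of 3-periodics `P₁(t) P₂(t) P₃(t)` with `P₁(t) = (a cos t, b sin t)`. -/
def IsThreePeriodicFamily (a b : ℝ) (P₂ P₃ : ℝ → Plane) : Prop :=
  ∀ t : ℝ, IsThreePeriodic a b (ellipsePoint a b t) (P₂ t) (P₃ t)

/-- The point with trilinear coordinates `x : y : z` with respect to the triangle `p q r`; the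
sidelengths opposite to `p`, `q`, `r` are `dist q r`, `dist r p`, `dist p q`. -/
def ofTrilinears (x y z : ℝ) (p q r : Plane) : Plane :=
  (dist q r * x + dist r p * y + dist p q * z)⁻¹ •
    ((dist q r * x) • p + (dist r p * y) • q + (dist p q * z) • r)

/-- The trilinear centre function `s₂ + s₃ - 2 s₁` of `X₄₄`. -/
def h44 (s₁ s₂ s₃ : ℝ) : ℝ := s₂ + s₃ - 2 * s₁

/-- The triangle centre `X₈₈`, the isogonal conjugate of `X₄₄`, that is, the point with the
trilinears `1 / (s₂ + s₃ - 2 s₁) : 1 / (s₃ + s₁ - 2 s₂) : 1 / (s₁ + s₂ - 2 s₃)`. The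
denominators are cleared (the conjugate of `x : y : z` is `y z : z x : x y`), so that the point
is also the right one where one of them vanishes; it is then a vertex of the triangle. -/
def X88 (p q r : Plane) : Plane :=
  let x := h44 (dist q r) (dist r p) (dist p q)
  let y := h44 (dist r p) (dist p q) (dist q r)
  let z := h44 (dist p q) (dist q r) (dist r p)
  ofTrilinears (y * z) (z * x) (x * y) p q r

/-- Trilinear coordinates are homogeneous. -/
theorem ofTrilinears_mul {k : ℝ} (hk : k ≠ 0) (x y z : ℝ) (p q r : Plane) :
    ofTrilinears (k * x) (k * y) (k * z) p q r = ofTrilinears x y z p q r := by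
  unfold ofTrilinears
  have h1 : dist q r * (k * x) + dist r p * (k * y) + dist p q * (k * z)
      = k * (dist q r * x + dist r p * y + dist p q * z) := by ring
  have h2 : (dist q r * (k * x)) • p + (dist r p * (k * y)) • q + (dist p q * (k * z)) • r
      = k • ((dist q r * x) • p + (dist r p * y) • q + (dist p q * z) • r) := by
    simp only [smul_add, smul_smul, mul_left_comm]
  rw [h1, h2, smul_smul, mul_inv_rev, mul_assoc, inv_mul_cancel₀ hk, mul_one]

/-- Where no denominator vanishes, `X88` has the reciprocal trilinears of `X₄₄`. -/
theorem X88_eq_reciprocal (p q r : Plane)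
    (hx : h44 (dist q r) (dist r p) (dist p q) ≠ 0)
    (hy : h44 (dist r p) (dist p q) (dist q r) ≠ 0)
    (hz : h44 (dist p q) (dist q r) (dist r p) ≠ 0) :
    X88 p q r = ofTrilinears (1 / h44 (dist q r) (dist r p) (dist p q))
      (1 / h44 (dist r p) (dist p q) (dist q r))
      (1 / h44 (dist p q) (dist q r) (dist r p)) p q r := by
  rw [← ofTrilinears_mul (mul_ne_zero (mul_ne_zero hx hy) hz)]
  unfold X88
  field_simp

/-- `p q r` is isosceles with apex `p` and the horizontal axis as its axis of symmetry. -/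
def IsSidewaysAt (p q r : Plane) : Prop :=
  p 1 = 0 ∧ q 0 = r 0 ∧ q 1 = -r 1

/-- The triangle `p q r` is a sideways isosceles: it is isosceles, and the horizontal axis is
its axis of symmetry. -/
def IsSidewaysIsosceles (p q r : Plane) : Prop :=
  IsSidewaysAt p q r ∨ IsSidewaysAt q r p ∨ IsSidewaysAt r p q

/-- The aspect ratio `α₈₈`. -/
def alpha88 : ℝ := Real.sqrt (6 + 2 * Real.sqrt 2) / 2

end EllipticBilliard

end

/-!
The affine map `(x, y) ↦ x / a + i y / b` takes the billiard to the unit circle of `ℂ`. Three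
observations make the motion of `X₈₈` explicit there.

The cosine of the angle between a side and the normal at one of its endpoints is, up to the norm of
the normal vector, the ratio of `D` to the length of the side, where `D = 1 - ⟪z, w⟫` is half of the
squared chord on the unit circle (`inner_normalVec`, `reflectsAt_iff`). Since `D` is symmetric, the
reflection law says that `D = J * dist` on the three sides with a common `J`
(`IsThreePeriodic.exists_ratio`). In particular the sidelengths are proportional to the squared
sides of the triangle on the unit circle.

The squared length of a side is `D * (a² + b² - (a² - b²) Re (z w))`, so that `D = J * dist` becomes
the bilinear relation `D = J² (a² + b²) - g Re (z w)` with `g = J² (a² - b²)`. For three distinct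
points it means that they are the zeros of `Z³ + g l Z² - g Z - l`, `l = z₁ z₂ z₃`
(`isBlaschkeTriple_of_diagForm`); this is the equation `B(Z) = l` for the Blaschke product
`B(Z) = Z (Z² - g) / (1 - g Z²)`. Summing the relation over the sides determines `g` from `a` and
`b` by a quadratic equation (`eq_causticParam`). Hence `l = B(e^{it}) = e^{iφ(t)}` with `φ' > 0`
(`exp_tripleAngle`, `hasDerivAt_tripleAngle`), and the 3-periodic is a sideways isosceles if and
only if `l = ±1` (`isSidewaysIsosceles_iff`).

The barycentric weights of `X₈₈` are `sᵢ / uᵢ`, where `u₁ = s₂ + s₃ - 2 s₁` and so on, and the `sᵢ`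
are proportional to the squared sides on the unit circle. With respect to the triangle on the unit
circle, the image of `X₈₈` is therefore the isogonal conjugate of the point with the barycentric
weights `uᵢ`, which is at infinity since `u₁ + u₂ + u₃ = 0`. Its direction is that of
`d = l + k * conj l` with `k = 6 g / (9 + g²)` (`IsBlaschkeTriple.direction_eq`). So the image of
`X₈₈` is on the circle, at `-l * conj d / d` (`circlePoint_X88`). Its argument is `θ = π - φ + 2 arg (1 + k e^{2iφ})`, with
`dθ/dφ = (3 k² - 1 + 2 k cos 2φ) / (1 + 2 k cos 2φ + k²)` (`hasDerivAt_centerAngle`). The maximum of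
the numerator, at `l = ±1`, is `(3 k - 1) (k + 1)`. The motion therefore changes its character at
`k = 1 / 3`, that is, at `a / b = α₈₈` (`exists_pos_mul_third_sub`), where the numerator is
`-(4 / 3) sin² φ` and `sin θ` is a positive multiple of `sin³ φ`.
-/

namespace EllipticBilliard

open Complex ComplexConjugate

/-! ### Sidelengths and the reflection law -/

/-- The image of `p` under the affine map that takes the ellipse to the unit circle of `ℂ`. -/
noncomputable def circlePoint (a b : ℝ) (p : Plane) : ℂ := ⟨p 0 / a, p 1 / b⟩

/-- `1 - ⟪z, w⟫`, which for points of the unit circle is half of the squared chord. -/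
noncomputable def chordDefect (z w : ℂ) : ℝ := 1 - (z.re * w.re + z.im * w.im)

theorem chordDefect_comm (z w : ℂ) : chordDefect z w = chordDefect w z := by
  unfold chordDefect; ring

theorem circlePoint_normSq {a b : ℝ} {p : Plane} (hp : p ∈ boundary a b) :
    (circlePoint a b p).re ^ 2 + (circlePoint a b p).im ^ 2 = 1 := hp

theorem circlePoint_injective {a b : ℝ} (ha : a ≠ 0) (hb : b ≠ 0) :
    Function.Injective (circlePoint a b) := by
  intro p q h
  have h0 := congrArg Complex.re h
  have h1 := congrArg Complex.im h
  simp only [circlePoint] at h0 h1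
  ext i
  fin_cases i
  · simpa [ha] using h0
  · simpa [hb] using h1

theorem chordDefect_pos {z w : ℂ} (hz : z.re ^ 2 + z.im ^ 2 = 1) (hw : w.re ^ 2 + w.im ^ 2 = 1)
    (h : z ≠ w) : 0 < chordDefect z w := by
  have h2 : 2 * chordDefect z w = (z.re - w.re) ^ 2 + (z.im - w.im) ^ 2 := by
    unfold chordDefect; linear_combination -hz - hw
  by_contra hle
  apply h
  have h3 := sq_nonneg (z.re - w.re)
  have h4 := sq_nonneg (z.im - w.im)
  apply Complex.ext
  · have : (z.re - w.re) ^ 2 = 0 := by linarith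
    linarith [pow_eq_zero_iff (two_ne_zero) |>.1 this]
  · have : (z.im - w.im) ^ 2 = 0 := by linarith
    linarith [pow_eq_zero_iff (two_ne_zero) |>.1 this]

theorem dist_sq_eq (p q : Plane) : dist p q ^ 2 = (p 0 - q 0) ^ 2 + (p 1 - q 1) ^ 2 := by
  rw [EuclideanSpace.dist_eq, Real.sq_sqrt (by positivity), Fin.sum_univ_two, Real.dist_eq,
    Real.dist_eq, sq_abs, sq_abs]

theorem dist_sq_eq_chordDefect {a b : ℝ} (ha : a ≠ 0) (hb : b ≠ 0) {p q : Plane}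
    (hp : p ∈ boundary a b) (hq : q ∈ boundary a b) :
    dist p q ^ 2 = chordDefect (circlePoint a b p) (circlePoint a b q) *
      (a ^ 2 + b ^ 2 - (a ^ 2 - b ^ 2) * ((circlePoint a b p).re * (circlePoint a b q).re
        - (circlePoint a b p).im * (circlePoint a b q).im)) := by
  have h1 := circlePoint_normSq hp
  have h2 := circlePoint_normSq hq
  have hx (r : Plane) : r 0 = a * (circlePoint a b r).re := by simp [circlePoint]; field_simp
  have hy (r : Plane) : r 1 = b * (circlePoint a b r).im := by simp [circlePoint]; field_simp
  rw [dist_sq_eq, hx p, hx q, hy p, hy q]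
  generalize circlePoint a b p = z at *
  generalize circlePoint a b q = w at *
  unfold chordDefect
  obtain ⟨x, y⟩ := z
  obtain ⟨u, v⟩ := w
  simp only at *
  linear_combination a ^ 2 * (v ^ 2 * h1 + (1 - x ^ 2) * h2) +
    b ^ 2 * (u ^ 2 * h1 + (1 - y ^ 2) * h2)

theorem inner_normalVec {a b : ℝ} {p q : Plane} (hq : q ∈ boundary a b) :
    inner ℝ (p - q) (normalVec a b q) =
      -chordDefect (circlePoint a b p) (circlePoint a b q) := by
  have h2 := circlePoint_normSq hq
  simp only [circlePoint, chordDefect, normalVec] at *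
  rw [PiLp.inner_apply]
  simp [Fin.sum_univ_two]
  linear_combination -h2

theorem normalVec_ne_zero {a b : ℝ} {q : Plane} (hq : q ∈ boundary a b) :
    normalVec a b q ≠ 0 := by
  intro h
  have h0 : q 0 / a ^ 2 = 0 := by simpa [normalVec] using congrFun (congrArg WithLp.ofLp h) 0
  have h1 : q 1 / b ^ 2 = 0 := by simpa [normalVec] using congrFun (congrArg WithLp.ofLp h) 1
  have h2 : (q 0 / a) ^ 2 + (q 1 / b) ^ 2 = 1 := hq
  have h3 : q 0 / a = 0 := by
    rcases div_eq_zero_iff.1 h0 with h | h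
    · simp [h]
    · simp [pow_eq_zero_iff (two_ne_zero) |>.1 h]
  have h4 : q 1 / b = 0 := by
    rcases div_eq_zero_iff.1 h1 with h | h
    · simp [h]
    · simp [pow_eq_zero_iff (two_ne_zero) |>.1 h]
  simp [h3, h4] at h2

/-- Both angles in the reflection law have the cosine `-D / (dist * ‖normal‖)`, with the chord
defect `D` of the segment. -/
theorem reflectsAt_iff {a b : ℝ} {p q r : Plane} (hq : q ∈ boundary a b) (hpq : p ≠ q)
    (hrq : r ≠ q) :
    ReflectsAt a b p q r ↔
      chordDefect (circlePoint a b p) (circlePoint a b q) / dist p q =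
        chordDefect (circlePoint a b q) (circlePoint a b r) / dist q r := by
  have hn : ‖normalVec a b q‖ ≠ 0 := norm_ne_zero_iff.2 (normalVec_ne_zero hq)
  have hp : dist p q ≠ 0 := dist_ne_zero.2 hpq
  have hr : dist r q ≠ 0 := dist_ne_zero.2 hrq
  unfold ReflectsAt
  have key : ReflectsAt a b p q r ↔
      inner ℝ (p - q) (normalVec a b q) / (‖p - q‖ * ‖normalVec a b q‖) =
      inner ℝ (r - q) (normalVec a b q) / (‖r - q‖ * ‖normalVec a b q‖) := by
    constructor
    · intro h
      have := congrArg Real.cos h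
      rwa [InnerProductGeometry.cos_angle, InnerProductGeometry.cos_angle] at this
    · intro h
      unfold ReflectsAt InnerProductGeometry.angle
      rw [h]
  unfold ReflectsAt at key
  rw [key, inner_normalVec hq, inner_normalVec hq, ← dist_eq_norm, ← dist_eq_norm,
    chordDefect_comm _ (circlePoint a b r), dist_comm q r]
  field_simp
  rw [neg_inj]

/-- Along a 3-periodic the ratio of the chord defect to the length of a side is constant. -/
theorem IsThreePeriodic.exists_ratio {a b : ℝ} (ha : a ≠ 0) (hb : b ≠ 0) {p q r : Plane}
    (h : IsThreePeriodic a b p q r) :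
    ∃ J : ℝ, 0 < J ∧
      chordDefect (circlePoint a b q) (circlePoint a b r) = J * dist q r ∧
      chordDefect (circlePoint a b r) (circlePoint a b p) = J * dist r p ∧
      chordDefect (circlePoint a b p) (circlePoint a b q) = J * dist p q := by
  have h1 := (reflectsAt_iff h.mem_q h.p_ne_q h.q_ne_r.symm).1 h.reflects_q
  have h2 := (reflectsAt_iff h.mem_r h.q_ne_r h.r_ne_p.symm).1 h.reflects_r
  have d1 : 0 < dist p q := dist_pos.2 h.p_ne_q
  have d2 : 0 < dist q r := dist_pos.2 h.q_ne_r
  have d3 : 0 < dist r p := dist_pos.2 h.r_ne_p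
  have c1 := chordDefect_pos (circlePoint_normSq h.mem_p) (circlePoint_normSq h.mem_q)
    ((circlePoint_injective ha hb).ne h.p_ne_q)
  refine ⟨chordDefect (circlePoint a b p) (circlePoint a b q) / dist p q, div_pos c1 d1,
    ?_, ?_, ?_⟩
  · rw [h1, div_mul_cancel₀ _ d2.ne']
  · rw [h1, h2, div_mul_cancel₀ _ d3.ne']
  · rw [div_mul_cancel₀ _ d1.ne']

theorem isThreePeriodic_of_ratio {a b : ℝ} {p q r : Plane}
    (hp : p ∈ boundary a b) (hq : q ∈ boundary a b) (hr : r ∈ boundary a b)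
    (hpq : p ≠ q) (hqr : q ≠ r) (hrp : r ≠ p) {J : ℝ}
    (h1 : chordDefect (circlePoint a b q) (circlePoint a b r) = J * dist q r)
    (h2 : chordDefect (circlePoint a b r) (circlePoint a b p) = J * dist r p)
    (h3 : chordDefect (circlePoint a b p) (circlePoint a b q) = J * dist p q) :
    IsThreePeriodic a b p q r := by
  have d1 : dist p q ≠ 0 := dist_ne_zero.2 hpq
  have d2 : dist q r ≠ 0 := dist_ne_zero.2 hqr
  have d3 : dist r p ≠ 0 := dist_ne_zero.2 hrp
  refine ⟨hp, hq, hr, hpq, hqr, hrp, ?_, ?_, ?_⟩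
  · rw [reflectsAt_iff hp hrp hpq.symm, h2, h3]; field_simp
  · rw [reflectsAt_iff hq hpq hqr.symm, h1, h3]; field_simp
  · rw [reflectsAt_iff hr hqr hrp.symm, h1, h2]; field_simp

/-! ### Blaschke triples and the isogonal conjugate of a point at infinity -/

/-- Three points of the unit circle that are the zeros of `Z ^ 3 + g l Z ^ 2 - g Z - l`, where
`l` is their product: the triples on which the Blaschke product `Z (Z ^ 2 - g) / (1 - g Z ^ 2)`
takes a common unimodular value `l`. -/
structure IsBlaschkeTriple (g : ℝ) (z₁ z₂ z₃ : ℂ) : Prop where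
  unit₁ : z₁ * conj z₁ = 1
  unit₂ : z₂ * conj z₂ = 1
  unit₃ : z₃ * conj z₃ = 1
  sum_eq : z₁ + z₂ + z₃ = -g * (z₁ * z₂ * z₃)
  pairs_eq : z₁ * z₂ + z₂ * z₃ + z₃ * z₁ = -g

theorem mul_conj_eq_one {z : ℂ} (hz : z.re ^ 2 + z.im ^ 2 = 1) : z * conj z = 1 := by
  rw [Complex.mul_conj, Complex.normSq_apply,
    show z.re * z.re + z.im * z.im = 1 by linear_combination hz, Complex.ofReal_one]

theorem two_mul_chordDefect (z w : ℂ) :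
    2 * (chordDefect z w : ℂ) = 2 - z * conj w - w * conj z := by
  apply Complex.ext <;> simp [chordDefect] <;> ring

theorem two_mul_diagForm (G : ℝ) (z w : ℂ) :
    2 * (((1 - G) * (z.re * w.re) + (1 + G) * (z.im * w.im) : ℝ) : ℂ) =
      z * conj w + w * conj z - G * (z * w + conj z * conj w) := by
  apply Complex.ext <;> simp <;> ring

theorem sq_sub_mul_of_diagForm {G : ℝ} {κ z₁ z₂ z₃ w₁ w₂ w₃ : ℂ}
    (h₁ : z₁ * w₁ = 1) (h₂ : z₂ * w₂ = 1) (h₃ : z₃ * w₃ = 1) (hne : z₂ ≠ z₃)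
    (h₁₂ : z₁ * w₂ + z₂ * w₁ - G * (z₁ * z₂ + w₁ * w₂) = κ)
    (h₃₁ : z₃ * w₁ + z₁ * w₃ - G * (z₃ * z₁ + w₃ * w₁) = κ) :
    z₁ ^ 2 - z₂ * z₃ + G * z₁ * (z₁ * z₂ * z₃) - G = 0 := by
  have hz₁ : z₁ ≠ 0 := left_ne_zero_of_mul_eq_one h₁
  have hz₂ : z₂ ≠ 0 := left_ne_zero_of_mul_eq_one h₂
  have hz₃ : z₃ ≠ 0 := left_ne_zero_of_mul_eq_one h₃
  rw [eq_inv_of_mul_eq_one_right h₁, eq_inv_of_mul_eq_one_right h₂] at h₁₂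
  rw [eq_inv_of_mul_eq_one_right h₁, eq_inv_of_mul_eq_one_right h₃] at h₃₁
  have h := h₁₂.trans h₃₁.symm
  field_simp at h
  apply mul_left_cancel₀ (sub_ne_zero.2 hne)
  linear_combination -h

theorem isBlaschkeTriple_of_diagForm {G κ : ℝ} {z₁ z₂ z₃ : ℂ}
    (h₁ : z₁.re ^ 2 + z₁.im ^ 2 = 1) (h₂ : z₂.re ^ 2 + z₂.im ^ 2 = 1)
    (h₃ : z₃.re ^ 2 + z₃.im ^ 2 = 1) (n₁₂ : z₁ ≠ z₂) (n₂₃ : z₂ ≠ z₃) (n₃₁ : z₃ ≠ z₁)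
    (h₁₂ : (1 - G) * (z₁.re * z₂.re) + (1 + G) * (z₁.im * z₂.im) = κ)
    (h₂₃ : (1 - G) * (z₂.re * z₃.re) + (1 + G) * (z₂.im * z₃.im) = κ)
    (h₃₁ : (1 - G) * (z₃.re * z₁.re) + (1 + G) * (z₃.im * z₁.im) = κ) :
    IsBlaschkeTriple G z₁ z₂ z₃ := by
  have u₁ := mul_conj_eq_one h₁
  have u₂ := mul_conj_eq_one h₂
  have u₃ := mul_conj_eq_one h₃
  have k₁₂ := two_mul_diagForm G z₁ z₂
  have k₂₃ := two_mul_diagForm G z₂ z₃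
  have k₃₁ := two_mul_diagForm G z₃ z₁
  rw [h₁₂] at k₁₂
  rw [h₂₃] at k₂₃
  rw [h₃₁] at k₃₁
  have e₁ := sq_sub_mul_of_diagForm u₁ u₂ u₃ n₂₃ k₁₂.symm k₃₁.symm
  have e₂ := sq_sub_mul_of_diagForm u₂ u₃ u₁ n₃₁ k₂₃.symm k₁₂.symm
  have hs : z₁ + z₂ + z₃ = -G * (z₁ * z₂ * z₃) := by
    apply mul_left_cancel₀ (sub_ne_zero.2 n₁₂)
    linear_combination e₁ - e₂
  exact ⟨u₁, u₂, u₃, hs, by linear_combination z₁ * hs - e₁⟩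

namespace IsBlaschkeTriple

variable {g : ℝ} {z₁ z₂ z₃ : ℂ}

theorem unit_prod (h : IsBlaschkeTriple g z₁ z₂ z₃) :
    z₁ * z₂ * z₃ * conj (z₁ * z₂ * z₃) = 1 := by
  simp only [map_mul]
  linear_combination z₂ * conj z₂ * z₃ * conj z₃ * h.unit₁ + z₃ * conj z₃ * h.unit₂ + h.unit₃

theorem conj_sum_eq (h : IsBlaschkeTriple g z₁ z₂ z₃) :
    conj z₁ + conj z₂ + conj z₃ = -g * conj (z₁ * z₂ * z₃) := by
  simpa using congrArg conj h.sum_eq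

theorem rotate (h : IsBlaschkeTriple g z₁ z₂ z₃) : IsBlaschkeTriple g z₂ z₃ z₁ :=
  ⟨h.unit₂, h.unit₃, h.unit₁, by linear_combination h.sum_eq, by linear_combination h.pairs_eq⟩

/-- The Blaschke product takes the value `z₁ z₂ z₃` at each of the three points. -/
theorem prod_mul (h : IsBlaschkeTriple g z₁ z₂ z₃) :
    z₁ * z₂ * z₃ * (1 - g * z₁ ^ 2) = z₁ * (z₁ ^ 2 - g) := by
  linear_combination -z₁ ^ 2 * h.sum_eq + z₁ * h.pairs_eq

theorem sum_chordDefect (h : IsBlaschkeTriple g z₁ z₂ z₃) :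
    chordDefect z₂ z₃ + chordDefect z₃ z₁ + chordDefect z₁ z₂ = (9 - g ^ 2) / 2 := by
  have key : (2 : ℂ) * (chordDefect z₂ z₃ + chordDefect z₃ z₁ + chordDefect z₁ z₂)
      = 9 - g ^ 2 := by
    linear_combination two_mul_chordDefect z₂ z₃ + two_mul_chordDefect z₃ z₁ +
      two_mul_chordDefect z₁ z₂ - (conj z₁ + conj z₂ + conj z₃) * h.sum_eq
      + g * (z₁ * z₂ * z₃) * h.conj_sum_eq - g ^ 2 * h.unit_prod
      + h.unit₁ + h.unit₂ + h.unit₃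
  have key' : (2 : ℝ) * (chordDefect z₂ z₃ + chordDefect z₃ z₁ + chordDefect z₁ z₂)
      = 9 - g ^ 2 := by exact_mod_cast key
  linarith

/-- The product is real exactly if it is one of the points: `±1` is a zero of the cubic with
product `±1`. -/
theorem sq_prod_eq_one_cases (h : IsBlaschkeTriple g z₁ z₂ z₃) (hl : (z₁ * z₂ * z₃) ^ 2 = 1) :
    z₁ * z₂ * z₃ = z₁ ∨ z₁ * z₂ * z₃ = z₂ ∨ z₁ * z₂ * z₃ = z₃ := by
  have : (z₁ * z₂ * z₃ - z₁) * ((z₁ * z₂ * z₃ - z₂) * (z₁ * z₂ * z₃ - z₃)) = 0 := by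
    linear_combination (-(z₁ * z₂ * z₃) ^ 2) * h.sum_eq + z₁ * z₂ * z₃ * h.pairs_eq +
      (z₁ * z₂ * z₃ * (1 + g)) * hl
  rcases mul_eq_zero.1 this with h | h
  · exact .inl (sub_eq_zero.1 h)
  rcases mul_eq_zero.1 h with h | h
  · exact .inr (.inl (sub_eq_zero.1 h))
  · exact .inr (.inr (sub_eq_zero.1 h))

end IsBlaschkeTriple

/-- Lagrange's identity for weights of sum zero at points of the unit circle. -/
theorem weighted_sum_chords {z₁ z₂ z₃ w₁ w₂ w₃ u₁ u₂ u₃ : ℂ}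
    (h₁ : z₁ * w₁ = 1) (h₂ : z₂ * w₂ = 1) (h₃ : z₃ * w₃ = 1) (hu : u₁ + u₂ + u₃ = 0) :
    (2 - z₂ * w₃ - z₃ * w₂) * (u₂ * u₃) + (2 - z₃ * w₁ - z₁ * w₃) * (u₃ * u₁) +
      (2 - z₁ * w₂ - z₂ * w₁) * (u₁ * u₂) =
      -((u₁ * z₁ + u₂ * z₂ + u₃ * z₃) * (u₁ * w₁ + u₂ * w₂ + u₃ * w₃)) := by
  linear_combination (u₁ + u₂ + u₃) * hu + u₁ ^ 2 * h₁ + u₂ ^ 2 * h₂ + u₃ ^ 2 * h₃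

/-- With barycentric weights `|z₂ - z₃| ^ 2 / u₁` and so on, `u₁ + u₂ + u₃ = 0`, a point of the
circumcircle is obtained: the isogonal conjugate of the point at infinity `u₁ : u₂ : u₃`. -/
theorem weighted_sum_points {z₁ z₂ z₃ w₁ w₂ w₃ u₁ u₂ u₃ : ℂ}
    (h₁ : z₁ * w₁ = 1) (h₂ : z₂ * w₂ = 1) (h₃ : z₃ * w₃ = 1) (hu : u₁ + u₂ + u₃ = 0) :
    (2 - z₂ * w₃ - z₃ * w₂) * (u₂ * u₃) * z₁ + (2 - z₃ * w₁ - z₁ * w₃) * (u₃ * u₁) * z₂ +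
      (2 - z₁ * w₂ - z₂ * w₁) * (u₁ * u₂) * z₃ =
      z₁ * z₂ * z₃ * (u₁ * w₁ + u₂ * w₂ + u₃ * w₃) ^ 2 := by
  have hz₁ : z₁ ≠ 0 := left_ne_zero_of_mul_eq_one h₁
  have hz₂ : z₂ ≠ 0 := left_ne_zero_of_mul_eq_one h₂
  have hz₃ : z₃ ≠ 0 := left_ne_zero_of_mul_eq_one h₃
  rw [eq_inv_of_mul_eq_one_right h₁, eq_inv_of_mul_eq_one_right h₂,
    eq_inv_of_mul_eq_one_right h₃, show u₃ = -u₁ - u₂ by linear_combination hu]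
  field_simp
  ring

/-- The direction, as a complex number, of the point at infinity whose barycentric weights are those
by which the squared sides are divided in the weights of `X₈₈`. -/
theorem IsBlaschkeTriple.direction_eq {g : ℝ} {z₁ z₂ z₃ : ℂ} (h : IsBlaschkeTriple g z₁ z₂ z₃) :
    (h44 (chordDefect z₂ z₃) (chordDefect z₃ z₁) (chordDefect z₁ z₂) : ℂ) * z₁ +
      (h44 (chordDefect z₃ z₁) (chordDefect z₁ z₂) (chordDefect z₂ z₃) : ℂ) * z₂ +
      (h44 (chordDefect z₁ z₂) (chordDefect z₂ z₃) (chordDefect z₃ z₁) : ℂ) * z₃ =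
      g / 2 * ((9 + g ^ 2) * (z₁ * z₂ * z₃) + 6 * g * conj (z₁ * z₂ * z₃)) := by
  have h1 : z₁ * (2 - z₂ * conj z₃ - z₃ * conj z₂) + z₂ * (2 - z₃ * conj z₁ - z₁ * conj z₃) +
      z₃ * (2 - z₁ * conj z₂ - z₂ * conj z₁) =
      6 * (z₁ + z₂ + z₃) - 2 * (z₁ * z₂ + z₂ * z₃ + z₃ * z₁) ^ 2 * conj (z₁ * z₂ * z₃) := by
    have hz₁ : z₁ ≠ 0 := left_ne_zero_of_mul_eq_one h.unit₁
    have hz₂ : z₂ ≠ 0 := left_ne_zero_of_mul_eq_one h.unit₂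
    have hz₃ : z₃ ≠ 0 := left_ne_zero_of_mul_eq_one h.unit₃
    simp only [map_mul]
    rw [eq_inv_of_mul_eq_one_right h.unit₁, eq_inv_of_mul_eq_one_right h.unit₂,
      eq_inv_of_mul_eq_one_right h.unit₃]
    field_simp
    ring
  have h2 : ((chordDefect z₂ z₃ + chordDefect z₃ z₁ + chordDefect z₁ z₂ : ℝ) : ℂ)
      = (9 - g ^ 2) / 2 := by
    rw [h.sum_chordDefect]; push_cast; ring
  rw [h.pairs_eq] at h1
  push_cast at h2
  unfold h44
  push_cast
  linear_combination (z₁ + z₂ + z₃) * h2 - 3 / 2 * h1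
    - 3 / 2 * z₁ * two_mul_chordDefect z₂ z₃ - 3 / 2 * z₂ * two_mul_chordDefect z₃ z₁
    - 3 / 2 * z₃ * two_mul_chordDefect z₁ z₂ - (9 + g ^ 2) / 2 * h.sum_eq

/-! ### The 3-periodics of the elliptic billiard -/

/-- The parameter `g` of the Blaschke product whose triples are the 3-periodics. The affine map
to the unit circle takes the caustic to the ellipse with the foci `±√g`. -/
noncomputable def causticParam (a b : ℝ) : ℝ :=
  (2 * Real.sqrt (a ^ 4 - a ^ 2 * b ^ 2 + b ^ 4) - (a ^ 2 + b ^ 2)) / (a ^ 2 - b ^ 2)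

theorem sq_lt_sq_of_axes {a b : ℝ} (hb : 0 < b) (hab : b < a) : b ^ 2 < a ^ 2 := by
  nlinarith

theorem causticParam_quadratic {a b : ℝ} (hb : 0 < b) (hab : b < a) :
    (a ^ 2 - b ^ 2) * causticParam a b ^ 2 + 2 * (a ^ 2 + b ^ 2) * causticParam a b
      = 3 * (a ^ 2 - b ^ 2) := by
  have hc : a ^ 2 - b ^ 2 ≠ 0 := (sub_pos.2 (sq_lt_sq_of_axes hb hab)).ne'
  have hd : Real.sqrt (a ^ 4 - a ^ 2 * b ^ 2 + b ^ 4) ^ 2 = a ^ 4 - a ^ 2 * b ^ 2 + b ^ 4 :=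
    Real.sq_sqrt (by nlinarith [sq_nonneg (a ^ 2 - b ^ 2), sq_nonneg (a * b)])
  unfold causticParam
  generalize Real.sqrt (a ^ 4 - a ^ 2 * b ^ 2 + b ^ 4) = d at *
  field_simp
  linear_combination 4 * hd

theorem causticParam_pos {a b : ℝ} (hb : 0 < b) (hab : b < a) : 0 < causticParam a b := by
  have hc := sub_pos.2 (sq_lt_sq_of_axes hb hab)
  refine div_pos (sub_pos.2 ?_) hc
  have : (a ^ 2 + b ^ 2) / 2 < Real.sqrt (a ^ 4 - a ^ 2 * b ^ 2 + b ^ 4) :=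
    Real.lt_sqrt_of_sq_lt (by nlinarith [mul_pos hc hc])
  linarith

theorem causticParam_lt_one {a b : ℝ} (hb : 0 < b) (hab : b < a) : causticParam a b < 1 := by
  have hc := sub_pos.2 (sq_lt_sq_of_axes hb hab)
  have ha : 0 < a := hb.trans hab
  rw [causticParam, div_lt_one hc]
  have : Real.sqrt (a ^ 4 - a ^ 2 * b ^ 2 + b ^ 4) < a ^ 2 := by
    rw [Real.sqrt_lt' (by positivity)]
    nlinarith [mul_pos hc (pow_pos hb 2)]
  linarith

theorem eq_causticParam {a b G : ℝ} (hb : 0 < b) (hab : b < a) (hG : 0 < G)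
    (h : (a ^ 2 - b ^ 2) * G ^ 2 + 2 * (a ^ 2 + b ^ 2) * G = 3 * (a ^ 2 - b ^ 2)) :
    G = causticParam a b := by
  have hc := sub_pos.2 (sq_lt_sq_of_axes hb hab)
  have hg := causticParam_pos hb hab
  have hq := causticParam_quadratic hb hab
  set g := causticParam a b
  have hf : (G - g) * ((a ^ 2 - b ^ 2) * (G + g) + 2 * (a ^ 2 + b ^ 2)) = 0 := by
    linear_combination h - hq
  have : 0 < (a ^ 2 - b ^ 2) * (G + g) + 2 * (a ^ 2 + b ^ 2) := by positivity
  exact sub_eq_zero.1 ((mul_eq_zero.1 hf).resolve_right this.ne')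

/-- The relation between two vertices whose chord has the given ratio of defect to length is
bilinear: `1 - ⟪z, w⟫ = J ^ 2 (a ^ 2 + b ^ 2) - J ^ 2 (a ^ 2 - b ^ 2) Re (z w)`. -/
theorem diagForm_of_ratio {a b J : ℝ} (ha : a ≠ 0) (hb : b ≠ 0) {p q : Plane}
    (hp : p ∈ boundary a b) (hq : q ∈ boundary a b) (hpq : p ≠ q)
    (h : chordDefect (circlePoint a b p) (circlePoint a b q) = J * dist p q) :
    (1 - J ^ 2 * (a ^ 2 - b ^ 2)) * ((circlePoint a b p).re * (circlePoint a b q).re) +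
      (1 + J ^ 2 * (a ^ 2 - b ^ 2)) * ((circlePoint a b p).im * (circlePoint a b q).im)
      = 1 - J ^ 2 * (a ^ 2 + b ^ 2) := by
  have hD := chordDefect_pos (circlePoint_normSq hp) (circlePoint_normSq hq)
    ((circlePoint_injective ha hb).ne hpq)
  have hd := dist_sq_eq_chordDefect ha hb hp hq
  set z := circlePoint a b p
  set w := circlePoint a b q
  have h1 : chordDefect z w = J ^ 2 * (a ^ 2 + b ^ 2 - (a ^ 2 - b ^ 2) *
      (z.re * w.re - z.im * w.im)) := by
    apply mul_left_cancel₀ hD.ne'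
    linear_combination (chordDefect z w + J * dist p q) * h + J ^ 2 * hd
  unfold chordDefect at h1
  linear_combination -h1

theorem IsThreePeriodic.isBlaschkeTriple {a b : ℝ} (hb : 0 < b) (hab : b < a) {p q r : Plane}
    (h : IsThreePeriodic a b p q r) :
    IsBlaschkeTriple (causticParam a b) (circlePoint a b p) (circlePoint a b q)
      (circlePoint a b r) := by
  have hc := sub_pos.2 (sq_lt_sq_of_axes hb hab)
  have ha0 : a ≠ 0 := (hb.trans hab).ne'
  obtain ⟨J, hJ, h₂₃, h₃₁, h₁₂⟩ := h.exists_ratio ha0 hb.ne'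
  have k₂₃ := diagForm_of_ratio ha0 hb.ne' h.mem_q h.mem_r h.q_ne_r h₂₃
  have k₃₁ := diagForm_of_ratio ha0 hb.ne' h.mem_r h.mem_p h.r_ne_p h₃₁
  have k₁₂ := diagForm_of_ratio ha0 hb.ne' h.mem_p h.mem_q h.p_ne_q h₁₂
  have hinj := circlePoint_injective ha0 hb.ne'
  have T := isBlaschkeTriple_of_diagForm (circlePoint_normSq h.mem_p)
    (circlePoint_normSq h.mem_q) (circlePoint_normSq h.mem_r) (hinj.ne h.p_ne_q)
    (hinj.ne h.q_ne_r) (hinj.ne h.r_ne_p) k₁₂ k₂₃ k₃₁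
  have hs := T.sum_chordDefect
  have hre := congrArg Complex.re T.pairs_eq
  simp only [Complex.add_re, Complex.mul_re, Complex.neg_re, Complex.ofReal_re] at hre
  unfold chordDefect at hs
  rw [← eq_causticParam hb hab (G := J ^ 2 * (a ^ 2 - b ^ 2)) (by positivity)]
  · exact T
  · linear_combination 2 / 3 * (a ^ 2 - b ^ 2) * (hs + k₁₂ + k₂₃ + k₃₁
      + J ^ 2 * (a ^ 2 - b ^ 2) * hre)

/-- Conversely, a chord satisfying the bilinear relation with `κ = (g ^ 2 - 1) / 2` has the ratio
`√(g / (a ^ 2 - b ^ 2))` of defect to length. -/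
theorem ratio_of_diagForm {a b : ℝ} (hb : 0 < b) (hab : b < a) {p q : Plane}
    (hp : p ∈ boundary a b) (hq : q ∈ boundary a b) (hpq : p ≠ q)
    (h : (1 - causticParam a b) * ((circlePoint a b p).re * (circlePoint a b q).re) +
      (1 + causticParam a b) * ((circlePoint a b p).im * (circlePoint a b q).im)
      = (causticParam a b ^ 2 - 1) / 2) :
    chordDefect (circlePoint a b p) (circlePoint a b q) =
      Real.sqrt (causticParam a b / (a ^ 2 - b ^ 2)) * dist p q := by
  have hc := sub_pos.2 (sq_lt_sq_of_axes hb hab)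
  have ha0 : a ≠ 0 := (hb.trans hab).ne'
  have hg := causticParam_pos hb hab
  have hquad := causticParam_quadratic hb hab
  have hD := chordDefect_pos (circlePoint_normSq hp) (circlePoint_normSq hq)
    ((circlePoint_injective ha0 hb.ne').ne hpq)
  have hd := dist_sq_eq_chordDefect ha0 hb.ne' hp hq
  have hs : Real.sqrt (causticParam a b / (a ^ 2 - b ^ 2)) ^ 2 * (a ^ 2 - b ^ 2) =
      causticParam a b := by
    rw [Real.sq_sqrt (by positivity), div_mul_cancel₀ _ hc.ne']
  rw [← sq_eq_sq₀ hD.le (by positivity), mul_pow, hd]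
  generalize Real.sqrt (causticParam a b / (a ^ 2 - b ^ 2)) = J at *
  generalize circlePoint a b p = z at *
  generalize circlePoint a b q = w at *
  have hH : J ^ 2 * (a ^ 2 + b ^ 2) = (3 - causticParam a b ^ 2) / 2 := by
    apply mul_left_cancel₀ hc.ne'
    linear_combination (a ^ 2 + b ^ 2) * hs + hquad / 2
  have hlin : chordDefect z w = J ^ 2 * (a ^ 2 + b ^ 2) -
      J ^ 2 * (a ^ 2 - b ^ 2) * (z.re * w.re - z.im * w.im) := by
    rw [hH, mul_assoc, mul_comm (J ^ 2)] at *
    unfold chordDefect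
    linear_combination -h + (z.re * w.re - z.im * w.im) * hs
  linear_combination chordDefect z w * hlin

/-- The other two vertices are the intersections of the unit circle with the line
`⟪B z, ·⟫ = (g ^ 2 - 1) / 2`, where `B = diag (1 - g, 1 + g)`. -/
theorem exists_diagForm_triple {g x y : ℝ} (hg0 : 0 < g) (hg1 : g < 1) (h : x ^ 2 + y ^ 2 = 1) :
    ∃ x₂ y₂ x₃ y₃ : ℝ, x₂ ^ 2 + y₂ ^ 2 = 1 ∧ x₃ ^ 2 + y₃ ^ 2 = 1 ∧
      (1 - g) * (x * x₂) + (1 + g) * (y * y₂) = (g ^ 2 - 1) / 2 ∧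
      (1 - g) * (x₂ * x₃) + (1 + g) * (y₂ * y₃) = (g ^ 2 - 1) / 2 ∧
      (1 - g) * (x₃ * x) + (1 + g) * (y₃ * y) = (g ^ 2 - 1) / 2 := by
  -- `M = ‖B z‖ ^ 2`; the two intersections are `(c m ± s m^⊥) / M` with `m = B z`
  set m := (1 - g) * x with hm
  set n := (1 + g) * y with hn
  set M := m ^ 2 + n ^ 2 with hM
  have hMge : (1 - g) ^ 2 ≤ M := by
    have : M = (1 - g) ^ 2 + 4 * g * y ^ 2 := by
      rw [hM, hm, hn]; linear_combination (1 - g) ^ 2 * h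
    rw [this]; nlinarith [sq_nonneg y]
  have hM0 : 0 < M := lt_of_lt_of_le (by nlinarith) hMge
  set c := (g ^ 2 - 1) / 2 with hc
  have hcM : 0 < M - c ^ 2 := by
    have : c ^ 2 < (1 - g) ^ 2 := by
      have : c ^ 2 = (1 - g) ^ 2 * ((1 + g) / 2) ^ 2 := by rw [hc]; ring
      rw [this]
      have h1 : 0 < (1 - g) ^ 2 := by nlinarith
      have h2 : ((1 + g) / 2) ^ 2 < 1 := by nlinarith
      nlinarith
    linarith
  set s := Real.sqrt (M - c ^ 2) with hs
  have hss : s ^ 2 = M - c ^ 2 := Real.sq_sqrt hcM.le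
  have hlin (X Y : ℝ) : (1 - g) * (x * X) + (1 + g) * (y * Y) = m * X + n * Y := by
    rw [hm, hn]; ring
  have hquad : 2 * c ^ 2 - ((1 - g) * n ^ 2 + (1 + g) * m ^ 2) = c * M := by
    rw [hM, hm, hn, hc]; linear_combination -(1 - g ^ 2) ^ 2 / 2 * h
  refine ⟨(c * m - s * n) / M, (c * n + s * m) / M, (c * m + s * n) / M, (c * n - s * m) / M,
    ?_, ?_, ?_, ?_, ?_⟩
  · field_simp
    linear_combination (m ^ 2 + n ^ 2) * hss - M * hM
  · field_simp
    linear_combination (m ^ 2 + n ^ 2) * hss - M * hM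
  · rw [hlin]
    field_simp
    linear_combination -c * hM
  · have : (1 - g) * ((c * m - s * n) * (c * m + s * n)) +
        (1 + g) * ((c * n + s * m) * (c * n - s * m)) = c * M * M := by
      linear_combination M * hquad - ((1 - g) * n ^ 2 + (1 + g) * m ^ 2) * hss - 2 * c ^ 2 * hM
    field_simp
    linear_combination this
  · rw [mul_comm _ x, mul_comm _ y, hlin]
    field_simp
    linear_combination -c * hM

theorem circlePoint_ellipse {a b : ℝ} (ha : a ≠ 0) (hb : b ≠ 0) (x y : ℝ) :
    circlePoint a b !₂[a * x, b * y] = ⟨x, y⟩ := by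
  simp [circlePoint, ha, hb]

theorem mem_boundary_of_unit {a b : ℝ} (ha : a ≠ 0) (hb : b ≠ 0) {x y : ℝ}
    (h : x ^ 2 + y ^ 2 = 1) : (!₂[a * x, b * y] : Plane) ∈ boundary a b := by
  simpa [boundary, ha, hb] using h

theorem exists_isThreePeriodic {a b : ℝ} (hb : 0 < b) (hab : b < a) (t : ℝ) :
    ∃ q r : Plane, IsThreePeriodic a b (ellipsePoint a b t) q r := by
  have ha0 : a ≠ 0 := (hb.trans hab).ne'
  have hb0 : b ≠ 0 := hb.ne'
  have hg := causticParam_pos hb hab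
  have hg1 := causticParam_lt_one hb hab
  have hg2 : (causticParam a b ^ 2 - 1) / 2 < 0 := by nlinarith
  have h1 : Real.cos t ^ 2 + Real.sin t ^ 2 = 1 := by
    rw [add_comm]; exact Real.sin_sq_add_cos_sq t
  obtain ⟨x₂, y₂, x₃, y₃, h2, h3, k₁₂, k₂₃, k₃₁⟩ := exists_diagForm_triple hg hg1 h1
  -- the form is positive definite and `κ` is negative, so vertices that satisfy it differ
  have hdiff {x y u v : ℝ} (hk : (1 - causticParam a b) * (x * u) +
      (1 + causticParam a b) * (y * v) = (causticParam a b ^ 2 - 1) / 2) :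
      (!₂[a * x, b * y] : Plane) ≠ !₂[a * u, b * v] := by
    intro he
    have he' := congrArg (circlePoint a b) he
    rw [circlePoint_ellipse ha0 hb0, circlePoint_ellipse ha0 hb0, Complex.mk.injEq] at he'
    obtain ⟨rfl, rfl⟩ := he'
    nlinarith [mul_nonneg (sub_pos.2 hg1).le (mul_self_nonneg x),
      mul_nonneg (add_pos one_pos hg).le (mul_self_nonneg y)]
  have m₁ := mem_boundary_of_unit ha0 hb0 h1
  have m₂ := mem_boundary_of_unit ha0 hb0 h2
  have m₃ := mem_boundary_of_unit ha0 hb0 h3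
  exact ⟨!₂[a * x₂, b * y₂], !₂[a * x₃, b * y₃],
    isThreePeriodic_of_ratio m₁ m₂ m₃ (hdiff k₁₂) (hdiff k₂₃) (hdiff k₃₁)
    (ratio_of_diagForm hb hab m₂ m₃ (hdiff k₂₃)
      (by simpa [ellipsePoint, circlePoint_ellipse, ha0, hb0] using k₂₃))
    (ratio_of_diagForm hb hab m₃ m₁ (hdiff k₃₁)
      (by simpa [ellipsePoint, circlePoint_ellipse, ha0, hb0] using k₃₁))
    (ratio_of_diagForm hb hab m₁ m₂ (hdiff k₁₂)
      (by simpa [ellipsePoint, circlePoint_ellipse, ha0, hb0] using k₁₂))⟩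

/-! ### The motion of `X₈₈` in the coordinates of the unit circle -/

/-- The argument of `1 + κ e ^ (i ψ)`, for `|κ| < 1`. -/
noncomputable def phase (κ ψ : ℝ) : ℝ := Real.arctan (κ * Real.sin ψ / (1 + κ * Real.cos ψ))

theorem one_add_mul_cos_pos {κ : ℝ} (h : |κ| < 1) (ψ : ℝ) : 0 < 1 + κ * Real.cos ψ := by
  have h1 : |κ * Real.cos ψ| < 1 := by
    rw [abs_mul]
    exact (mul_le_of_le_one_right (abs_nonneg _) (Real.abs_cos_le_one _)).trans_lt h
  linarith [(abs_lt.1 h1).1]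

theorem one_add_two_mul_cos_pos {κ : ℝ} (h : |κ| < 1) (ψ : ℝ) :
    0 < 1 + 2 * κ * Real.cos ψ + κ ^ 2 := by
  have h1 := one_add_mul_cos_pos h ψ
  have h2 : 1 + 2 * κ * Real.cos ψ + κ ^ 2 =
      (1 + κ * Real.cos ψ) ^ 2 + (κ * Real.sin ψ) ^ 2 := by
    linear_combination -κ ^ 2 * Real.sin_sq_add_cos_sq ψ
  rw [h2]; positivity

theorem hasDerivAt_phase {κ : ℝ} (h : |κ| < 1) (ψ : ℝ) :
    HasDerivAt (phase κ) (κ * (Real.cos ψ + κ) / (1 + 2 * κ * Real.cos ψ + κ ^ 2)) ψ := by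
  have h1 := one_add_mul_cos_pos h ψ
  have h2 := one_add_two_mul_cos_pos h ψ
  have hd := (((Real.hasDerivAt_sin ψ).const_mul κ).div
    (((Real.hasDerivAt_cos ψ).const_mul κ).const_add 1) h1.ne').arctan
  refine hd.congr_deriv ?_
  have hsc := Real.sin_sq_add_cos_sq ψ
  simp only [Pi.div_apply]
  generalize Real.cos ψ = c at *
  generalize Real.sin ψ = s at *
  have h3 : 1 + 2 * κ * c + κ ^ 2 = (1 + κ * c) ^ 2 + (κ * s) ^ 2 := by
    linear_combination -κ ^ 2 * hsc
  rw [h3] at h2 ⊢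
  field_simp
  linear_combination κ ^ 2 * hsc

theorem exp_two_phase {κ : ℝ} (h : |κ| < 1) (ψ : ℝ) :
    exp (2 * phase κ ψ * I) * (1 + κ * exp (-(ψ * I))) = 1 + κ * exp (ψ * I) := by
  have h1 := (one_add_mul_cos_pos h ψ).ne'
  have hA : Real.sin (phase κ ψ) * (1 + κ * Real.cos ψ) =
      κ * Real.sin ψ * Real.cos (phase κ ψ) := by
    have h2 : Real.tan (phase κ ψ) = κ * Real.sin ψ / (1 + κ * Real.cos ψ) := Real.tan_arctan _
    have hcos : 0 < Real.cos (phase κ ψ) := Real.cos_arctan_pos _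
    rw [Real.tan_eq_sin_div_cos, div_eq_div_iff hcos.ne' h1] at h2
    exact h2
  have hA' : (Real.sin (phase κ ψ) * (1 + κ * Real.cos ψ) : ℂ) =
      κ * Real.sin ψ * Real.cos (phase κ ψ) := by exact_mod_cast hA
  have e0 : exp (2 * phase κ ψ * I) = exp (phase κ ψ * I) * exp (phase κ ψ * I) := by
    rw [← Complex.exp_add]; ring_nf
  have e1 : exp (phase κ ψ * I) * exp (-(phase κ ψ * I)) = 1 := by
    rw [← Complex.exp_add]; simp
  -- both sides of `e ^ (i A) (1 + κ e ^ (-i ψ)) = e ^ (-i A) (1 + κ e ^ (i ψ))` are real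
  have e2 : exp (phase κ ψ * I) * (1 + κ * exp (-(ψ * I))) =
      exp (-(phase κ ψ * I)) * (1 + κ * exp (ψ * I)) := by
    simp only [← neg_mul, exp_mul_I, Complex.cos_neg, Complex.sin_neg, ← Complex.ofReal_cos,
      ← Complex.ofReal_sin]
    linear_combination 2 * I * hA'
  rw [e0]
  linear_combination exp (phase κ ψ * I) * e2 + (1 + κ * exp (ψ * I)) * e1

/-- The argument of the product of the three vertices of the 3-periodic with first vertex at
the eccentric angle `t`, lifted to `ℝ`. -/
noncomputable def tripleAngle (g t : ℝ) : ℝ := 3 * t - 2 * phase (-g) (2 * t)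

theorem exp_tripleAngle {g : ℝ} (h0 : 0 < g) (h1 : g < 1) (t : ℝ) :
    exp (tripleAngle g t * I) * (1 - g * exp (t * I) ^ 2) =
      exp (t * I) * (exp (t * I) ^ 2 - g) := by
  have hp := exp_two_phase (κ := -g) (by rw [abs_neg, abs_of_pos h0]; exact h1) (2 * t)
  have e1 : exp (tripleAngle g t * I) * exp (2 * phase (-g) (2 * t) * I) = exp (t * I) ^ 3 := by
    rw [← Complex.exp_add, ← Complex.exp_nat_mul]
    congr 1
    unfold tripleAngle; push_cast; ring
  have e2 : exp (((2 * t : ℝ) : ℂ) * I) = exp (t * I) ^ 2 := by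
    rw [← Complex.exp_nat_mul]; congr 1; push_cast; ring
  rw [Complex.exp_neg, e2] at hp
  have hz : exp (t * I) ≠ 0 := Complex.exp_ne_zero _
  push_cast at hp
  generalize exp (t * I) = z at *
  field_simp at hp
  apply mul_left_cancel₀ (pow_ne_zero 2 hz)
  linear_combination (-exp (tripleAngle g t * I)) * hp + (z ^ 2 - g) * e1

theorem hasDerivAt_tripleAngle {g : ℝ} (h0 : 0 < g) (h1 : g < 1) (t : ℝ) :
    ∃ d : ℝ, 0 < d ∧ HasDerivAt (tripleAngle g) d t := by
  have hκ : |-g| < 1 := by rw [abs_neg, abs_of_pos h0]; exact h1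
  have hD := one_add_two_mul_cos_pos hκ (2 * t)
  have h2 : HasDerivAt (fun τ : ℝ => 2 * τ) 2 t := by
    simpa using (hasDerivAt_id t).const_mul 2
  have h3 : HasDerivAt (fun τ : ℝ => 3 * τ) 3 t := by
    simpa using (hasDerivAt_id t).const_mul 3
  have hd := h3.sub ((((hasDerivAt_phase hκ (2 * t)).comp t h2)).const_mul 2)
  refine ⟨_, ?_, hd⟩
  have hc := Real.cos_le_one (2 * t)
  have h4 : -g * (Real.cos (2 * t) + -g) / (1 + 2 * -g * Real.cos (2 * t) + (-g) ^ 2) < 3 / 4 := by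
    rw [div_lt_iff₀ hD]; nlinarith
  linarith

/-- The eccentric angle of `X₈₈` as a function of the argument `φ` of the product of the
vertices. -/
noncomputable def centerAngle (k φ : ℝ) : ℝ := Real.pi - φ + 2 * phase k (2 * φ)

theorem exp_centerAngle {k : ℝ} (h : |k| < 1) (φ : ℝ) :
    exp (centerAngle k φ * I) * (exp (φ * I) + k * conj (exp (φ * I))) =
      -(1 + k * exp (φ * I) ^ 2) := by
  have hp := exp_two_phase h (2 * φ)
  have hz : exp (φ * I) ≠ 0 := Complex.exp_ne_zero _
  have e1 : exp (centerAngle k φ * I) * exp (φ * I) = -exp (2 * phase k (2 * φ) * I) := by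
    rw [← Complex.exp_add, ← neg_one_mul, ← Complex.exp_pi_mul_I, ← Complex.exp_add]
    congr 1
    unfold centerAngle; push_cast; ring
  have e2 : exp (((2 * φ : ℝ) : ℂ) * I) = exp (φ * I) ^ 2 := by
    rw [← Complex.exp_nat_mul]; congr 1; push_cast; ring
  have e3 : conj (exp (φ * I)) = (exp (φ * I))⁻¹ := by
    rw [← Complex.exp_conj, ← Complex.exp_neg]; simp
  rw [Complex.exp_neg, e2] at hp
  rw [e3]
  generalize exp (φ * I) = z at *
  generalize exp (centerAngle k φ * I) = E at *
  field_simp at hp ⊢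
  apply mul_left_cancel₀ hz
  linear_combination (z ^ 2 + k) * e1 - hp

theorem hasDerivAt_centerAngle {k : ℝ} (h : |k| < 1) (φ : ℝ) :
    HasDerivAt (centerAngle k)
      ((3 * k ^ 2 - 1 + 2 * k * Real.cos (2 * φ)) / (1 + 2 * k * Real.cos (2 * φ) + k ^ 2)) φ := by
  have hD := one_add_two_mul_cos_pos h (2 * φ)
  have h2 : HasDerivAt (fun τ : ℝ => 2 * τ) 2 φ := by
    simpa using (hasDerivAt_id φ).const_mul 2
  have hd := ((hasDerivAt_id φ).const_sub Real.pi).add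
    ((((hasDerivAt_phase h (2 * φ)).comp φ h2)).const_mul 2)
  refine hd.congr_deriv ?_
  field_simp
  ring

/-- The sine of the eccentric angle of the centre, with the denominator cleared. -/
theorem sin_centerAngle {k : ℝ} (h : |k| < 1) (φ : ℝ) :
    Real.sin (centerAngle k φ) * (1 + 2 * k * Real.cos (2 * φ) + k ^ 2) =
      -(Real.sin φ * ((1 + k) * (3 * k - 1) * Real.cos φ ^ 2 - (1 - k) ^ 2 * Real.sin φ ^ 2)) := by
  have he := exp_centerAngle h φ
  have hsc := Real.sin_sq_add_cos_sq φ
  rw [Complex.exp_mul_I, Complex.exp_mul_I, ← Complex.ofReal_cos, ← Complex.ofReal_sin,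
    ← Complex.ofReal_cos, ← Complex.ofReal_sin] at he
  rw [Real.cos_two_mul]
  generalize Real.cos φ = c at *
  generalize Real.sin φ = s at *
  generalize Real.cos (centerAngle k φ) = C at *
  generalize Real.sin (centerAngle k φ) = S at *
  have hre := congrArg Complex.re he
  have him := congrArg Complex.im he
  simp [pow_two] at hre him
  linear_combination (c + k * c) * him - (s - k * s) * hre - (S * (1 - k) ^ 2 + s * (1 - k)) * hsc

/-- The parameter `k` of `X₈₈`, in terms of the parameter of the Blaschke product. -/
noncomputable def centerParam (g : ℝ) : ℝ := 6 * g / (9 + g ^ 2)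

theorem centerParam_pos {g : ℝ} (h0 : 0 < g) : 0 < centerParam g := by
  unfold centerParam; positivity

theorem abs_centerParam_lt_one {g : ℝ} (h0 : 0 < g) (h1 : g < 1) : |centerParam g| < 1 := by
  rw [abs_of_pos (centerParam_pos h0), centerParam, div_lt_one (by positivity)]
  nlinarith

/-- `X₈₈` in barycentric coordinates of the unit circle, where the weights can be computed from
the chord defects instead of the sidelengths, to which they are proportional. -/
theorem circlePoint_X88_mul (a b J : ℝ) (p q r : Plane) {σ₁ σ₂ σ₃ : ℝ}
    (h₁ : σ₁ = J * dist q r) (h₂ : σ₂ = J * dist r p) (h₃ : σ₃ = J * dist p q)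
    (hN : σ₁ * (h44 σ₂ σ₃ σ₁ * h44 σ₃ σ₁ σ₂) + σ₂ * (h44 σ₃ σ₁ σ₂ * h44 σ₁ σ₂ σ₃) +
      σ₃ * (h44 σ₁ σ₂ σ₃ * h44 σ₂ σ₃ σ₁) ≠ 0) :
    circlePoint a b (X88 p q r) *
      ((σ₁ * (h44 σ₂ σ₃ σ₁ * h44 σ₃ σ₁ σ₂) + σ₂ * (h44 σ₃ σ₁ σ₂ * h44 σ₁ σ₂ σ₃) +
      σ₃ * (h44 σ₁ σ₂ σ₃ * h44 σ₂ σ₃ σ₁) : ℝ) : ℂ) =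
      σ₁ * (h44 σ₂ σ₃ σ₁ * h44 σ₃ σ₁ σ₂) * circlePoint a b p +
      σ₂ * (h44 σ₃ σ₁ σ₂ * h44 σ₁ σ₂ σ₃) * circlePoint a b q +
      σ₃ * (h44 σ₁ σ₂ σ₃ * h44 σ₂ σ₃ σ₁) * circlePoint a b r := by
  have hJ (x y z : ℝ) : h44 (J * x) (J * y) (J * z) = J * h44 x y z := by
    unfold h44; ring
  subst h₁ h₂ h₃
  simp only [hJ] at *
  simp only [X88, ofTrilinears]
  generalize h44 (dist q r) (dist r p) (dist p q) = x at *
  generalize h44 (dist r p) (dist p q) (dist q r) = y at *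
  generalize h44 (dist p q) (dist q r) (dist r p) = z at *
  generalize dist q r = d₁ at *
  generalize dist r p = d₂ at *
  generalize dist p q = d₃ at *
  have hfac : J * d₁ * (J * y * (J * z)) + J * d₂ * (J * z * (J * x)) + J * d₃ * (J * x * (J * y))
      = J ^ 3 * (d₁ * (y * z) + d₂ * (z * x) + d₃ * (x * y)) := by ring
  have hn : d₁ * (y * z) + d₂ * (z * x) + d₃ * (x * y) ≠ 0 := by
    rw [hfac] at hN; exact right_ne_zero_of_mul hN
  rw [hfac]
  generalize hn' : d₁ * (y * z) + d₂ * (z * x) + d₃ * (x * y) = n at *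
  apply Complex.ext
  · simp [circlePoint, -Complex.ofReal_pow]
    field_simp
  · simp [circlePoint, -Complex.ofReal_pow]
    field_simp

/-- `X₈₈` is `-l * conj d / d`, where `l` is the product of the vertices and `d = l + k * conj l` the
direction of the point at infinity of which it is the isogonal conjugate on the unit circle. -/
theorem circlePoint_X88 {a b : ℝ} (hb : 0 < b) (hab : b < a) {p q r : Plane}
    (h : IsThreePeriodic a b p q r) {k : ℝ} (hk : k = centerParam (causticParam a b)) {l : ℂ}
    (hl : l = circlePoint a b p * circlePoint a b q * circlePoint a b r)
    (hd : l + k * conj l ≠ 0) :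
    circlePoint a b (X88 p q r) * (l + k * conj l) = -(1 + k * l ^ 2) := by
  have T := h.isBlaschkeTriple hb hab
  have hg0 := causticParam_pos hb hab
  obtain ⟨J, hJ, h₂₃, h₃₁, h₁₂⟩ := h.exists_ratio (hb.trans hab).ne' hb.ne'
  have hX := circlePoint_X88_mul a b J p q r h₂₃ h₃₁ h₁₂
  have hdir := T.direction_eq
  have hll := T.unit_prod
  have c₂₃ := two_mul_chordDefect (circlePoint a b q) (circlePoint a b r)
  have c₃₁ := two_mul_chordDefect (circlePoint a b r) (circlePoint a b p)
  have c₁₂ := two_mul_chordDefect (circlePoint a b p) (circlePoint a b q)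
  rw [← hl] at hdir hll
  generalize circlePoint a b p = z₁ at *
  generalize circlePoint a b q = z₂ at *
  generalize circlePoint a b r = z₃ at *
  generalize chordDefect z₂ z₃ = σ₁ at *
  generalize chordDefect z₃ z₁ = σ₂ at *
  generalize chordDefect z₁ z₂ = σ₃ at *
  have hu : (h44 σ₁ σ₂ σ₃ : ℂ) + h44 σ₂ σ₃ σ₁ + h44 σ₃ σ₁ σ₂ = 0 := by
    unfold h44; push_cast; ring
  have hden := weighted_sum_chords T.unit₁ T.unit₂ T.unit₃ hu
  have hnum := weighted_sum_points T.unit₁ T.unit₂ T.unit₃ hu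
  generalize h44 σ₁ σ₂ σ₃ = u₁ at *
  generalize h44 σ₂ σ₃ σ₁ = u₂ at *
  generalize h44 σ₃ σ₁ σ₂ = u₃ at *
  set g := causticParam a b
  set C : ℝ := g * (9 + g ^ 2) / 2 with hC
  have hC0 : (C : ℂ) ≠ 0 := by
    rw [Complex.ofReal_ne_zero]; positivity
  have hCk : C * k = 3 * g ^ 2 := by
    rw [hk, hC, centerParam]; field_simp; ring
  have hCk' : (C * k : ℂ) = 3 * g ^ 2 := by exact_mod_cast hCk
  have hdir' : (u₁ : ℂ) * z₁ + u₂ * z₂ + u₃ * z₃ = C * (l + k * conj l) := by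
    have hC' : (C : ℂ) = g * (9 + g ^ 2) / 2 := by rw [hC]; push_cast; rfl
    rw [hdir]
    linear_combination -l * hC' - conj l * hCk'
  have hdirc : (u₁ : ℂ) * conj z₁ + u₂ * conj z₂ + u₃ * conj z₃ = C * (conj l + k * l) := by
    simpa using congrArg conj hdir'
  have hd' : conj l + k * l ≠ 0 := by
    intro h0
    apply hd
    simpa using congrArg conj h0
  rw [hdir', hdirc] at hden
  rw [← hl, hdirc] at hnum
  -- the denominator of the trilinear formula is a negative multiple of `|d| ^ 2`
  have hN : ((σ₁ * (u₂ * u₃) + σ₂ * (u₃ * u₁) + σ₃ * (u₁ * u₂) : ℝ) : ℂ) =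
      -(C ^ 2 / 2 * ((l + k * conj l) * (conj l + k * l))) := by
    push_cast
    linear_combination (u₂ * u₃ * c₂₃ + u₃ * u₁ * c₃₁ + u₁ * u₂ * c₁₂ + hden) / 2
  have hN0 : σ₁ * (u₂ * u₃) + σ₂ * (u₃ * u₁) + σ₃ * (u₁ * u₂) ≠ 0 := by
    rw [← Complex.ofReal_ne_zero, hN]
    simp [hC0, hd, hd']
  specialize hX hN0
  rw [hN] at hX
  have hfac : (C : ℂ) ^ 2 / 2 * (conj l + k * l) ≠ 0 := by simp [hC0, hd']
  apply mul_left_cancel₀ hfac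
  linear_combination -hX - (u₂ * u₃ * z₁ * c₂₃ + u₃ * u₁ * z₂ * c₃₁ + u₁ * u₂ * z₃ * c₁₂ + hnum) / 2
    - C ^ 2 / 2 * (conj l + k * l) * hll

/-! ### The threshold `α₈₈` -/

theorem alpha88_pos : 0 < alpha88 := by
  unfold alpha88; positivity

theorem alpha88_sq : alpha88 ^ 2 = (3 + Real.sqrt 2) / 2 := by
  unfold alpha88
  rw [div_pow, Real.sq_sqrt (by positivity)]
  ring

theorem alpha88_isGreatest :
    IsGreatest {x : ℝ | 4 * x ^ 4 - 12 * x ^ 2 + 7 = 0} alpha88 := by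
  have h2 : Real.sqrt 2 ^ 2 = 2 := Real.sq_sqrt (by norm_num)
  have hs : 0 < Real.sqrt 2 := by positivity
  constructor
  · have h4 : alpha88 ^ 4 = (alpha88 ^ 2) ^ 2 := by ring
    simp only [Set.mem_ofPred_eq, h4, alpha88_sq]
    linear_combination h2
  · intro x hx
    simp only [Set.mem_ofPred_eq] at hx
    by_contra! hlt'
    have hlt := pow_lt_pow_left₀ hlt' alpha88_pos.le two_ne_zero
    rw [alpha88_sq] at hlt
    have : 0 < (x ^ 2 - (3 + Real.sqrt 2) / 2) * (x ^ 2 - (3 - Real.sqrt 2) / 2) :=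
      mul_pos (by linarith) (by linarith)
    nlinarith

/-- The sign of `1 / 3 - k` is that of `α₈₈ ^ 2 - (a / b) ^ 2`: the value `k = 1 / 3` is attained
at `g = 9 - 6 √2`, where the quadratic equation for `g` gives `(a / b) ^ 2 = (3 + √2) / 2`. -/
theorem exists_pos_mul_third_sub {a b : ℝ} (hb : 0 < b) (hab : b < a) :
    ∃ m : ℝ, 0 < m ∧ 1 / 3 - centerParam (causticParam a b) = m * (alpha88 ^ 2 - (a / b) ^ 2) := by
  have hc := sub_pos.2 (sq_lt_sq_of_axes hb hab)
  have hg0 := causticParam_pos hb hab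
  have hg1 := causticParam_lt_one hb hab
  have hq := causticParam_quadratic hb hab
  have h2 : Real.sqrt 2 ^ 2 = 2 := Real.sq_sqrt (by norm_num)
  have hs1 : 7 / 5 < Real.sqrt 2 := Real.lt_sqrt_of_sq_lt (by norm_num)
  have hs2 : Real.sqrt 2 < 3 / 2 := by rw [Real.sqrt_lt' (by norm_num)]; norm_num
  rw [alpha88_sq]
  set g := causticParam a b
  set w := Real.sqrt 2
  have hP : 0 < (a ^ 2 - b ^ 2) * (9 - 6 * w + g) + 2 * (a ^ 2 + b ^ 2) := by
    have : 0 < 9 - 6 * w + g := by linarith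
    positivity
  have h3 : 0 < 9 + 6 * w - g := by linarith
  have h4 : 0 < 9 + g ^ 2 := by positivity
  have h5 : 0 < 120 * w - 168 := by linarith
  have key : (9 - 6 * w - g) * ((a ^ 2 - b ^ 2) * (9 - 6 * w + g) + 2 * (a ^ 2 + b ^ 2)) =
      (120 * w - 168) * ((3 + w) / 2 * b ^ 2 - a ^ 2) := by
    linear_combination (36 * (a ^ 2 - b ^ 2) - 60 * b ^ 2) * h2 - hq
  refine ⟨(120 * w - 168) * b ^ 2 * (9 + 6 * w - g) /
    (3 * (9 + g ^ 2) * ((a ^ 2 - b ^ 2) * (9 - 6 * w + g) + 2 * (a ^ 2 + b ^ 2))), ?_, ?_⟩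
  · positivity
  · unfold centerParam
    generalize hPdef : (a ^ 2 - b ^ 2) * (9 - 6 * w + g) + 2 * (a ^ 2 + b ^ 2) = P at *
    field_simp
    linear_combination 2 * (9 + 6 * w - g) * key + 72 * P * h2

theorem centerParam_lt_third {a b : ℝ} (hb : 0 < b) (hab : b < a) (h : a / b < alpha88) :
    centerParam (causticParam a b) < 1 / 3 := by
  obtain ⟨m, hm, he⟩ := exists_pos_mul_third_sub hb hab
  have h0 : 0 < a / b := div_pos (hb.trans hab) hb
  have : 0 < alpha88 ^ 2 - (a / b) ^ 2 := sub_pos.2 (pow_lt_pow_left₀ h h0.le two_ne_zero)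
  nlinarith [mul_pos hm this]

theorem centerParam_eq_third {a b : ℝ} (hb : 0 < b) (hab : b < a) (h : a / b = alpha88) :
    centerParam (causticParam a b) = 1 / 3 := by
  obtain ⟨m, -, he⟩ := exists_pos_mul_third_sub hb hab
  rw [h, sub_self, mul_zero] at he
  linarith

theorem third_lt_centerParam {a b : ℝ} (hb : 0 < b) (hab : b < a) (h : alpha88 < a / b) :
    1 / 3 < centerParam (causticParam a b) := by
  obtain ⟨m, hm, he⟩ := exists_pos_mul_third_sub hb hab
  have : 0 < (a / b) ^ 2 - alpha88 ^ 2 :=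
    sub_pos.2 (pow_lt_pow_left₀ h alpha88_pos.le two_ne_zero)
  nlinarith [mul_pos hm this]

theorem circlePoint_ellipsePoint {a b : ℝ} (ha : a ≠ 0) (hb : b ≠ 0) (t : ℝ) :
    circlePoint a b (ellipsePoint a b t) = exp (t * I) := by
  rw [ellipsePoint, circlePoint_ellipse ha hb, Complex.exp_mul_I, ← Complex.ofReal_cos,
    ← Complex.ofReal_sin, Complex.mk_eq_add_mul_I]

/-- With vertices on the unit circle, the apex of a sideways isosceles is `±1` and the other two
vertices are conjugate, hence of product `1`. -/
theorem isSidewaysAt_iff {a b : ℝ} (ha : a ≠ 0) (hb : b ≠ 0) {p q r : Plane} {g : ℝ}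
    (T : IsBlaschkeTriple g (circlePoint a b p) (circlePoint a b q) (circlePoint a b r)) :
    IsSidewaysAt p q r ↔
      circlePoint a b p * circlePoint a b q * circlePoint a b r = circlePoint a b p ∧
        (circlePoint a b p * circlePoint a b q * circlePoint a b r) ^ 2 = 1 := by
  have hz : circlePoint a b p ≠ 0 := left_ne_zero_of_mul_eq_one T.unit₁
  have h1 : IsSidewaysAt p q r ↔ conj (circlePoint a b p) = circlePoint a b p ∧
      circlePoint a b q = conj (circlePoint a b r) := by
    rw [Complex.conj_eq_iff_im, Complex.ext_iff]
    simp only [IsSidewaysAt, circlePoint, Complex.conj_re, Complex.conj_im]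
    rw [div_left_inj' ha, ← neg_div, div_left_inj' hb, div_eq_zero_iff, or_iff_left hb]
  rw [h1]
  have u₁ := T.unit₁
  have u₃ := T.unit₃
  generalize circlePoint a b p = z₁ at *
  generalize circlePoint a b q = z₂ at *
  generalize circlePoint a b r = z₃ at *
  have hz₃ : z₃ ≠ 0 := left_ne_zero_of_mul_eq_one u₃
  constructor
  · rintro ⟨h, rfl⟩
    have : z₁ * conj z₃ * z₃ = z₁ := by linear_combination z₁ * u₃
    refine ⟨this, ?_⟩
    rw [this]
    rw [h] at u₁
    linear_combination u₁
  · rintro ⟨h, h'⟩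
    rw [h] at h'
    constructor
    · apply mul_left_cancel₀ hz
      linear_combination u₁ - h'
    · apply mul_left_cancel₀ hz
      apply mul_right_cancel₀ hz₃
      linear_combination h - z₁ * u₃

theorem isSidewaysIsosceles_iff {a b : ℝ} (ha : a ≠ 0) (hb : b ≠ 0) {p q r : Plane} {g : ℝ}
    (T : IsBlaschkeTriple g (circlePoint a b p) (circlePoint a b q) (circlePoint a b r)) :
    IsSidewaysIsosceles p q r ↔
      (circlePoint a b p * circlePoint a b q * circlePoint a b r) ^ 2 = 1 := by
  unfold IsSidewaysIsosceles
  rw [isSidewaysAt_iff ha hb T, isSidewaysAt_iff ha hb T.rotate,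
    isSidewaysAt_iff ha hb T.rotate.rotate]
  have hcases := T.sq_prod_eq_one_cases
  generalize circlePoint a b p = z₁ at *
  generalize circlePoint a b q = z₂ at *
  generalize circlePoint a b r = z₃ at *
  rw [show z₂ * z₃ * z₁ = z₁ * z₂ * z₃ by ring, show z₃ * z₁ * z₂ = z₁ * z₂ * z₃ by ring]
  tauto

theorem one_sub_mul_exp_sq_ne_zero {g : ℝ} (h0 : 0 < g) (h1 : g < 1) (t : ℝ) :
    1 - (g : ℂ) * exp (t * I) ^ 2 ≠ 0 := by
  intro h
  have h2 := congrArg norm (sub_eq_zero.1 h)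
  rw [norm_mul, norm_pow, Complex.norm_exp_ofReal_mul_I, Complex.norm_real, Real.norm_eq_abs,
    abs_of_pos h0] at h2
  norm_num at h2
  linarith

theorem add_mul_conj_exp_ne_zero {k : ℝ} (h : |k| < 1) (φ : ℝ) :
    exp (φ * I) + k * conj (exp (φ * I)) ≠ 0 := by
  intro h0
  have h2 := congrArg norm (eq_neg_of_add_eq_zero_left h0)
  rw [norm_neg, norm_mul, RCLike.norm_conj, Complex.norm_exp_ofReal_mul_I, Complex.norm_real,
    Real.norm_eq_abs] at h2
  linarith

theorem exp_sq_eq_one_iff (φ : ℝ) : exp (φ * I) ^ 2 = 1 ↔ Real.sin φ = 0 := by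
  rw [← Complex.exp_nat_mul, Complex.exp_eq_one_iff, Real.sin_eq_zero_iff]
  refine exists_congr fun n => ?_
  rw [eq_comm, show (n : ℂ) * (2 * Real.pi * I) = (2 : ℕ) * ((n * Real.pi : ℂ) * I) by
    push_cast; ring, mul_right_inj' (by norm_num), mul_left_inj' Complex.I_ne_zero]
  norm_cast

theorem prod_eq_exp_tripleAngle {a b : ℝ} (hb : 0 < b) (hab : b < a) {t : ℝ} {q r : Plane}
    (h : IsThreePeriodic a b (ellipsePoint a b t) q r) :
    circlePoint a b (ellipsePoint a b t) * circlePoint a b q * circlePoint a b r =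
      exp (tripleAngle (causticParam a b) t * I) := by
  have hg0 := causticParam_pos hb hab
  have hg1 := causticParam_lt_one hb hab
  have h1 := (h.isBlaschkeTriple hb hab).prod_mul
  have h2 := exp_tripleAngle hg0 hg1 t
  rw [← circlePoint_ellipsePoint (hb.trans hab).ne' hb.ne' t] at h2
  rw [← h1] at h2
  refine (mul_right_cancel₀ ?_ h2).symm
  rw [circlePoint_ellipsePoint (hb.trans hab).ne' hb.ne' t]
  exact one_sub_mul_exp_sq_ne_zero hg0 hg1 t

/-- A 3-periodic with given first vertex is a sideways isosceles when the product of the vertices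
is real. -/
theorem isSidewaysIsosceles_iff_sin {a b : ℝ} (hb : 0 < b) (hab : b < a) {t : ℝ} {q r : Plane}
    (h : IsThreePeriodic a b (ellipsePoint a b t) q r) :
    IsSidewaysIsosceles (ellipsePoint a b t) q r ↔
      Real.sin (tripleAngle (causticParam a b) t) = 0 := by
  rw [isSidewaysIsosceles_iff (hb.trans hab).ne' hb.ne' (h.isBlaschkeTriple hb hab),
    prod_eq_exp_tripleAngle hb hab h, exp_sq_eq_one_iff]

/-- The eccentric angle of `X₈₈` for the 3-periodic with first vertex at the eccentric angle
`t`. -/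
noncomputable def X88Angle (a b t : ℝ) : ℝ :=
  centerAngle (centerParam (causticParam a b)) (tripleAngle (causticParam a b) t)

theorem X88_eq_ellipsePoint {a b : ℝ} (hb : 0 < b) (hab : b < a) {t : ℝ} {q r : Plane}
    (h : IsThreePeriodic a b (ellipsePoint a b t) q r) :
    X88 (ellipsePoint a b t) q r = ellipsePoint a b (X88Angle a b t) := by
  have hk := abs_centerParam_lt_one (causticParam_pos hb hab) (causticParam_lt_one hb hab)
  have ha0 := (hb.trans hab).ne'
  apply circlePoint_injective ha0 hb.ne'
  rw [circlePoint_ellipsePoint ha0 hb.ne']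
  have hd := add_mul_conj_exp_ne_zero hk (tripleAngle (causticParam a b) t)
  apply mul_right_cancel₀ hd
  rw [X88Angle, exp_centerAngle hk]
  exact circlePoint_X88 hb hab h rfl (prod_eq_exp_tripleAngle hb hab h).symm hd

theorem hasDerivAt_X88Angle {a b : ℝ} (hb : 0 < b) (hab : b < a) (t : ℝ) :
    ∃ d : ℝ, 0 < d ∧ HasDerivAt (X88Angle a b)
      ((3 * centerParam (causticParam a b) ^ 2 - 1 + 2 * centerParam (causticParam a b) *
        Real.cos (2 * tripleAngle (causticParam a b) t)) * d) t := by
  have hg0 := causticParam_pos hb hab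
  have hg1 := causticParam_lt_one hb hab
  have hk := abs_centerParam_lt_one hg0 hg1
  obtain ⟨d, hd, h⟩ := hasDerivAt_tripleAngle hg0 hg1 t
  have hD := one_add_two_mul_cos_pos hk (2 * tripleAngle (causticParam a b) t)
  refine ⟨_, div_pos hd hD, ((hasDerivAt_centerAngle hk _).comp t h).congr_deriv ?_⟩
  ring

theorem differentiable_X88Angle {a b : ℝ} (hb : 0 < b) (hab : b < a) :
    Differentiable ℝ (X88Angle a b) := fun t => by
  obtain ⟨d, -, h⟩ := hasDerivAt_X88Angle hb hab t
  exact h.differentiableAt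

theorem deriv_X88Angle_neg {a b : ℝ} (hb : 0 < b) (hab : b < a) (h : a / b < alpha88) (t : ℝ) :
    deriv (X88Angle a b) t < 0 := by
  obtain ⟨d, hd, hD⟩ := hasDerivAt_X88Angle hb hab t
  have hk0 := centerParam_pos (causticParam_pos hb hab)
  have hk := centerParam_lt_third hb hab h
  rw [hD.deriv]
  refine mul_neg_of_neg_of_pos ?_ hd
  nlinarith [Real.cos_le_one (2 * tripleAngle (causticParam a b) t)]

theorem tripleAngle_zero (g : ℝ) : tripleAngle g 0 = 0 := by
  simp [tripleAngle, phase]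

theorem tripleAngle_pi_div_two (g : ℝ) : tripleAngle g (Real.pi / 2) = 3 * (Real.pi / 2) := by
  simp [tripleAngle, phase, mul_div_cancel₀]

theorem exists_deriv_X88Angle_neg {a b : ℝ} (hb : 0 < b) (hab : b < a) :
    ∃ t, deriv (X88Angle a b) t < 0 := by
  refine ⟨Real.pi / 2, ?_⟩
  obtain ⟨d, hd, hD⟩ := hasDerivAt_X88Angle hb hab (Real.pi / 2)
  have hk0 := centerParam_pos (causticParam_pos hb hab)
  have hk := abs_centerParam_lt_one (causticParam_pos hb hab) (causticParam_lt_one hb hab)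
  rw [abs_of_pos hk0] at hk
  rw [hD.deriv, tripleAngle_pi_div_two,
    show 2 * (3 * (Real.pi / 2)) = Real.pi + 2 * Real.pi by ring, Real.cos_add_two_pi,
    Real.cos_pi]
  refine mul_neg_of_neg_of_pos ?_ hd
  nlinarith

theorem deriv_X88Angle_zero_pos {a b : ℝ} (hb : 0 < b) (hab : b < a) (h : alpha88 < a / b) :
    0 < deriv (X88Angle a b) 0 := by
  obtain ⟨d, hd, hD⟩ := hasDerivAt_X88Angle hb hab 0
  have hk := third_lt_centerParam hb hab h
  rw [hD.deriv, tripleAngle_zero, mul_zero, Real.cos_zero]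
  refine mul_pos ?_ hd
  nlinarith

theorem hasDerivAt_X88Angle_threshold {a b : ℝ} (hb : 0 < b) (hab : b < a)
    (h : a / b = alpha88) (t : ℝ) :
    ∃ d : ℝ, 0 < d ∧ HasDerivAt (X88Angle a b)
      (-(Real.sin (tripleAngle (causticParam a b) t) ^ 2 * d)) t := by
  obtain ⟨d, hd, hD⟩ := hasDerivAt_X88Angle hb hab t
  refine ⟨4 / 3 * d, by positivity, hD.congr_deriv ?_⟩
  rw [centerParam_eq_third hb hab h, Real.cos_two_mul, Real.cos_sq']
  ring

theorem deriv_X88Angle_eq_zero_iff {a b : ℝ} (hb : 0 < b) (hab : b < a)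
    (h : a / b = alpha88) (t : ℝ) :
    deriv (X88Angle a b) t = 0 ↔ Real.sin (tripleAngle (causticParam a b) t) = 0 := by
  obtain ⟨d, hd, hD⟩ := hasDerivAt_X88Angle_threshold hb hab h t
  rw [hD.deriv, neg_eq_zero, mul_eq_zero, or_iff_left hd.ne', pow_eq_zero_iff two_ne_zero]

theorem strictAnti_X88Angle {a b : ℝ} (hb : 0 < b) (hab : b < a) (h : a / b = alpha88) :
    StrictAnti (X88Angle a b) := by
  have hanti : Antitone (X88Angle a b) := by
    refine antitone_of_deriv_nonpos (differentiable_X88Angle hb hab) fun t => ?_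
    obtain ⟨d, hd, hD⟩ := hasDerivAt_X88Angle_threshold hb hab h t
    rw [hD.deriv, neg_nonpos]
    positivity
  intro x y hxy
  refine lt_of_le_of_ne (hanti hxy.le) fun heq => ?_
  -- otherwise `θ` is constant on `[x, y]`, so that `sin φ` vanishes near the midpoint, where its
  -- derivative is `± φ' ≠ 0`
  have hconst : ∀ s ∈ Set.Ioo x y, X88Angle a b s = X88Angle a b x := fun s hs =>
    le_antisymm (hanti hs.1.le) (heq ▸ hanti hs.2.le)
  have hzero : ∀ s ∈ Set.Ioo x y, Real.sin (tripleAngle (causticParam a b) s) = 0 := by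
    intro s hs
    rw [← deriv_X88Angle_eq_zero_iff hb hab h]
    have : X88Angle a b =ᶠ[nhds s] fun _ => X88Angle a b x :=
      Filter.eventually_of_mem (isOpen_Ioo.mem_nhds hs) hconst
    rw [this.deriv_eq, deriv_const]
  have hm : (x + y) / 2 ∈ Set.Ioo x y := ⟨by linarith, by linarith⟩
  obtain ⟨d, hd, hD⟩ := hasDerivAt_tripleAngle (causticParam_pos hb hab)
    (causticParam_lt_one hb hab) ((x + y) / 2)
  have h1 := hD.sin
  have h2 : HasDerivAt (fun s => Real.sin (tripleAngle (causticParam a b) s)) 0 ((x + y) / 2) :=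
    (hasDerivAt_const _ (0 : ℝ)).congr_of_eventuallyEq
      (Filter.eventually_of_mem (isOpen_Ioo.mem_nhds hm) hzero)
  have h3 := (mul_eq_zero.1 (h1.unique h2)).resolve_right hd.ne'
  have h4 := Real.sin_sq_add_cos_sq (tripleAngle (causticParam a b) ((x + y) / 2))
  rw [h3, hzero _ hm] at h4
  norm_num at h4

theorem sin_X88Angle_eq_zero_iff {a b : ℝ} (hb : 0 < b) (hab : b < a)
    (h : a / b = alpha88) (t : ℝ) :
    Real.sin (X88Angle a b t) = 0 ↔ Real.sin (tripleAngle (causticParam a b) t) = 0 := by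
  have hk := abs_centerParam_lt_one (causticParam_pos hb hab) (causticParam_lt_one hb hab)
  have h1 := sin_centerAngle hk (tripleAngle (causticParam a b) t)
  have hD := one_add_two_mul_cos_pos hk (2 * tripleAngle (causticParam a b) t)
  rw [centerParam_eq_third hb hab h] at h1 hD
  rw [X88Angle, centerParam_eq_third hb hab h]
  constructor
  · intro h0
    rw [h0] at h1
    refine (pow_eq_zero_iff three_ne_zero).1 ?_
    linear_combination -9 / 4 * h1
  · intro h0
    rw [h0] at h1
    refine (mul_eq_zero.1 (h1.trans ?_)).resolve_right hD.ne'
    ring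

theorem ellipsePoint_mem_vertices_iff {a b : ℝ} (hb : b ≠ 0) (θ : ℝ) :
    ellipsePoint a b θ ∈ ({!₂[a, 0], !₂[-a, 0]} : Set Plane) ↔ Real.sin θ = 0 := by
  constructor
  · rintro (h | h)
    · simpa [ellipsePoint, hb] using congrFun (congrArg WithLp.ofLp h) 1
    · have h : ellipsePoint a b θ = !₂[-a, 0] := h
      simpa [ellipsePoint, hb] using congrFun (congrArg WithLp.ofLp h) 1
  · intro h
    rcases Real.sin_eq_zero_iff_cos_eq.1 h with h1 | h1
    · left; simp [ellipsePoint, h, h1]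
    · right; simp [ellipsePoint, h, h1]

end EllipticBilliard

theorem mainTheorem4 :
    -- `α₈₈` is the largest root of `4 x ^ 4 - 12 x ^ 2 + 7`
    IsGreatest {x : ℝ | 4 * x ^ 4 - 12 * x ^ 2 + 7 = 0} EllipticBilliard.alpha88 ∧
    ∀ a b : ℝ, 0 < b → b < a →
      -- the family of 3-periodics exists
      (∃ P₂ P₃ : ℝ → EllipticBilliard.Plane,
        EllipticBilliard.IsThreePeriodicFamily a b P₂ P₃) ∧
      ∀ P₂ P₃ : ℝ → EllipticBilliard.Plane,
        EllipticBilliard.IsThreePeriodicFamily a b P₂ P₃ →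
        -- at `t = 0` the 3-periodic is a sideways isosceles
        EllipticBilliard.IsSidewaysIsosceles
          (EllipticBilliard.ellipsePoint a b 0) (P₂ 0) (P₃ 0) ∧
        -- at `a / b = α₈₈`, the `y` velocity of `X₈₈` vanishes at a sideways isosceles
        (a / b = EllipticBilliard.alpha88 →
          ∀ t : ℝ, EllipticBilliard.IsSidewaysIsosceles
              (EllipticBilliard.ellipsePoint a b t) (P₂ t) (P₃ t) →
            HasDerivAt
              (fun τ : ℝ =>
                EllipticBilliard.X88 (EllipticBilliard.ellipsePoint a b τ) (P₂ τ) (P₃ τ) 1)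
              0 t) ∧
        -- `X₈₈` moves on the billiard, with the eccentric angle `θ`
        ∃ θ : ℝ → ℝ, Differentiable ℝ θ ∧
          (∀ t : ℝ, EllipticBilliard.X88 (EllipticBilliard.ellipsePoint a b t) (P₂ t) (P₃ t) =
            EllipticBilliard.ellipsePoint a b (θ t)) ∧
          -- below the threshold: clockwise, without stops
          (a / b < EllipticBilliard.alpha88 → ∀ t : ℝ, deriv θ t < 0) ∧
          -- at the threshold: clockwise, with stops exactly at the left and right vertices of
          -- the billiard, which is exactly at the sideways isosceles 3-periodics
          (a / b = EllipticBilliard.alpha88 →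
            StrictAnti θ ∧
            ∀ t : ℝ,
              (deriv θ t = 0 ↔ EllipticBilliard.IsSidewaysIsosceles
                (EllipticBilliard.ellipsePoint a b t) (P₂ t) (P₃ t)) ∧
              (deriv θ t = 0 ↔
                EllipticBilliard.X88 (EllipticBilliard.ellipsePoint a b t) (P₂ t) (P₃ t) ∈
                  ({!₂[a, 0], !₂[-a, 0]} : Set EllipticBilliard.Plane))) ∧
          -- above the threshold: clockwise at some times, counterclockwise at others
          (EllipticBilliard.alpha88 < a / b →
            (∃ t : ℝ, deriv θ t < 0) ∧ ∃ t : ℝ, 0 < deriv θ t) := by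
  refine ⟨EllipticBilliard.alpha88_isGreatest, fun a b hb hab => ⟨?_, fun P₂ P₃ hP => ⟨?_, ?_,
    EllipticBilliard.X88Angle a b, EllipticBilliard.differentiable_X88Angle hb hab,
    fun t => EllipticBilliard.X88_eq_ellipsePoint hb hab (hP t),
    EllipticBilliard.deriv_X88Angle_neg hb hab, fun h =>
      ⟨EllipticBilliard.strictAnti_X88Angle hb hab h, fun t => ⟨?_, ?_⟩⟩,
    fun h => ⟨EllipticBilliard.exists_deriv_X88Angle_neg hb hab, 0,
      EllipticBilliard.deriv_X88Angle_zero_pos hb hab h⟩⟩⟩⟩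
  · choose P₂ P₃ hP using fun t => EllipticBilliard.exists_isThreePeriodic hb hab t
    exact ⟨P₂, P₃, hP⟩
  · rw [EllipticBilliard.isSidewaysIsosceles_iff_sin hb hab (hP 0),
      EllipticBilliard.tripleAngle_zero, Real.sin_zero]
  · intro h t ht
    rw [EllipticBilliard.isSidewaysIsosceles_iff_sin hb hab (hP t),
      ← EllipticBilliard.deriv_X88Angle_eq_zero_iff hb hab h] at ht
    have hy : (fun τ : ℝ =>
        EllipticBilliard.X88 (EllipticBilliard.ellipsePoint a b τ) (P₂ τ) (P₃ τ) 1) =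
        fun τ => b * Real.sin (EllipticBilliard.X88Angle a b τ) := by
      funext τ
      rw [EllipticBilliard.X88_eq_ellipsePoint hb hab (hP τ)]
      simp [EllipticBilliard.ellipsePoint]
    rw [hy]
    have hd := ((EllipticBilliard.differentiable_X88Angle hb hab t).hasDerivAt.sin).const_mul b
    simpa [ht] using hd
  · rw [EllipticBilliard.deriv_X88Angle_eq_zero_iff hb hab h,
      EllipticBilliard.isSidewaysIsosceles_iff_sin hb hab (hP t)]
  · rw [EllipticBilliard.deriv_X88Angle_eq_zero_iff hb hab h,
      EllipticBilliard.X88_eq_ellipsePoint hb hab (hP t),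
      EllipticBilliard.ellipsePoint_mem_vertices_iff hb.ne',
      EllipticBilliard.sin_X88Angle_eq_zero_iff hb hab h]
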